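/- Let $K$ be an arbitrary field. For a set $Z$ write $\mathbb{A}_K(Z)$ for the free associative unital $K$-algebra with basis $Z$. Let $X$ and $Y$ be disjoint non-empty sets, and regard $\mathbb{A}_K(X)$ as a subring of $\mathbb{A}_K(X \cup Y)$ through the canonical embedding that sends each $x \in X$ to $x$. Then $\mathbb{A}_K(X)$ is an elementary subring of $\mathbb{A}_K(X \cup Y)$ if and only if $X$ is infinite. Here a subring $A$ of a ring $B$ is called elementary if for every formula $\varphi(x_1,\dots,x_n)$ of the first-order language of rings with identity and all $a_1,\dots,a_n \in A$, the formula $\varphi(a_1,\dots,a_n)$ holds in $A$ if and only if it holds in $B$. -/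

import Mathlib

universe u v

open FirstOrder

/-- The substructure, in the first-order language of rings with identity `(+, *, -, 0, 1)`,
carried by a subring. -/
def Subring.toRingSubstructure {R : Type u} [Ring R] [Ring.CompatibleRing R] (S : Subring R) :
    Language.ring.Substructure R where
  carrier := S
  fun_mem := by
    intro n f x hx
    cases f with
    | add =>
      have h := S.add_mem (hx 0) (hx 1)
      rwa [← Ring.CompatibleRing.funMap_add] at h
    | mul =>
      have h := S.mul_mem (hx 0) (hx 1)
      rwa [← Ring.CompatibleRing.funMap_mul] at h
    | neg =>
      have h := S.neg_mem (hx 0)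
      rwa [← Ring.CompatibleRing.funMap_neg] at h
    | zero =>
      have h := S.zero_mem
      rwa [← Ring.CompatibleRing.funMap_zero x] at h
    | one =>
      have h := S.one_mem
      rwa [← Ring.CompatibleRing.funMap_one x] at h

/-- `S` is an elementary subring of `R`: every first-order formula of the language of rings
takes the same truth value in `S` and in `R` at every tuple of elements of `S`. -/
def Subring.IsElementary {R : Type u} [Ring R] (S : Subring R) : Prop :=
  letI : Ring.CompatibleRing R := Ring.compatibleRingOfRing R
  S.toRingSubstructure.IsElementary

/-- The canonical homomorphism of free associative unital `K`-algebras `A_K(X) → A_K(Z)`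
for sets of free generators `X ⊆ Z`: the `K`-algebra map that sends each `x ∈ X` to itself. -/
def freeAlgebraInclusion (K : Type u) [Field K] {U : Type v} {X Z : Set U} (h : X ⊆ Z) :
    FreeAlgebra K X →ₐ[K] FreeAlgebra K Z :=
  FreeAlgebra.lift K fun x => FreeAlgebra.ι K (Set.inclusion h x)

/-- The canonical homomorphism `A_K(X) → A_K(Z)` is an embedding, so `A_K(X)` is identified
with its image. -/
theorem freeAlgebraInclusion_injective (K : Type u) [Field K] {U : Type v} {X Z : Set U}
    (h : X ⊆ Z) : Function.Injective (freeAlgebraInclusion K h) := by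
  classical
  let g : FreeAlgebra K Z →ₐ[K] FreeAlgebra K X :=
    FreeAlgebra.lift K fun z => if hz : (z : U) ∈ X then FreeAlgebra.ι K ⟨z, hz⟩ else 0
  have hg : g.comp (freeAlgebraInclusion K h) = AlgHom.id K _ := by
    ext x
    simp [g, freeAlgebraInclusion]
  intro a b hab
  have := congrArg g hab
  simpa [← AlgHom.comp_apply, hg] using this

/-- `A_K(X)` as a subring of `A_K(Z)`, for sets of free generators `X ⊆ Z`. -/
def freeSubring (K : Type u) [Field K] {U : Type v} {X Z : Set U} (h : X ⊆ Z) :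
    Subring (FreeAlgebra K Z) :=
  (freeAlgebraInclusion K h : FreeAlgebra K X →+* FreeAlgebra K Z).range

/-! For infinite `X`, use the Tarski–Vaught test. Finitely many parameters from A_K(X) and one
element of A_K(Z) involve finitely many generators. A permutation of Z fixes those of the parameters
and moves those of the element into `X`, and it induces a ring automorphism
(`Subring.isElementary_of_exists_ringEquiv`). For finite `X`, every element of A_K(X) is a constant
plus some ∑ x_i b_i. The language cannot name constants, but each constant c satisfies c v c = c for
some v, so a first-order formula in the x_i records this
(`Subring.IsElementary.exists_regular_sub_sum`). It fails in A_K(Z) for a generator y outside `X`: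
killing `X` would make y invertible in K[y]. -/

section Transfer

open FirstOrder.Ring

theorem exists_ringTerm_realize_sum {R : Type*} [Ring R] [CompatibleRing R] {α β : Type*}
    (s : Finset β) (f : β → Language.ring.Term α) :
    ∃ t : Language.ring.Term α, ∀ v : α → R,
      t.realize v = ∑ i ∈ s, (f i).realize v := by
  classical
  induction s using Finset.induction_on with
  | empty => exact ⟨0, by simp⟩
  | insert i s hi ih =>
    obtain ⟨t, ht⟩ := ih
    exact ⟨f i + t, fun v => by simp [Finset.sum_insert hi, ht]⟩

/-- The property "every element is the sum of a von Neumann regular element and an element of the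
right ideal generated by `x`" passes from an elementary subring to the ring. -/
theorem Subring.IsElementary.exists_regular_sub_sum {R : Type*} [Ring R] {S : Subring R}
    (hS : S.IsElementary) {ι : Type*} [Fintype ι] (x : ι → S)
    (h : ∀ a : S, ∃ (b : ι → S) (v : S),
      (a - ∑ i, x i * b i) * v * (a - ∑ i, x i * b i) = a - ∑ i, x i * b i) (a : R) :
    ∃ (b : ι → R) (v : R),
      (a - ∑ i, (x i : R) * b i) * v * (a - ∑ i, (x i : R) * b i)
        = a - ∑ i, (x i : R) * b i := by
  let _ : CompatibleRing R := compatibleRingOfRing R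
  let E : Language.ring.ElementarySubstructure R := ⟨S.toRingSubstructure, hS⟩
  -- Variables: parameters x_i, then the universally quantified a, then the existential b_i (`some
  -- i`) and v (`none`).
  let V := (ι ⊕ Unit) ⊕ Option ι
  obtain ⟨t, ht⟩ := exists_ringTerm_realize_sum (R := R) (α := V) Finset.univ fun i : ι =>
    Language.Term.var (.inl (.inl i)) * Language.Term.var (.inr (some i))
  let p : Language.ring.Term V := Language.Term.var (.inl (.inr ())) + -t
  let ψ : Language.ring.Formula V :=
    Language.Term.equal (p * Language.Term.var (.inr none) * p) p
  let φ : Language.ring.Formula ι := (ψ.iExs (Option ι)).iAlls Unit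
  have hψ (w : V → R) : ψ.Realize w ↔
      (w (.inl (.inr ())) - ∑ i, w (.inl (.inl i)) * w (.inr (some i))) * w (.inr none)
        * (w (.inl (.inr ())) - ∑ i, w (.inl (.inl i)) * w (.inr (some i)))
        = w (.inl (.inr ())) - ∑ i, w (.inl (.inl i)) * w (.inr (some i)) := by
    simp [ψ, p, Language.Formula.realize_equal, ht, sub_eq_add_neg]
  -- `t` is known to be the sum only in `R`; ψ is a single equation, so the embedding of `E`
  -- preserves and reflects it.
  have hψE (w : V → E) : ψ.Realize w ↔ ψ.Realize (E.subtype ∘ w) := by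
    simp only [ψ, Language.Formula.realize_equal, Language.HomClass.realize_term,
      EmbeddingLike.apply_eq_iff_eq]
  let y : ι → E := fun i => ⟨x i, (x i).2⟩
  have hφE : φ.Realize y := by
    refine Language.Formula.realize_iAlls.2 fun c => Language.Formula.realize_iExs.2 ?_
    obtain ⟨b, v, hbv⟩ := h ⟨c (), (c ()).2⟩
    refine ⟨fun o => (⟨_, (o.elim v b).2⟩ : E), ?_⟩
    rw [hψE, hψ]
    have := congrArg S.subtype hbv
    simp only [map_mul, map_sub, map_sum] at this
    exact this
  have hφ : φ.Realize (E.subtype ∘ y) := (E.subtype.map_formula φ y).2 hφE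
  obtain ⟨w, hw⟩ := Language.Formula.realize_iExs.1
    (Language.Formula.realize_iAlls.1 hφ fun _ => a)
  rw [hψ] at hw
  exact ⟨fun i => w (some i), w none, hw⟩

/-- A subring is elementary if any element of the ring can be moved into it by an automorphism
fixing any prescribed finite tuple of elements of the subring. -/
theorem Subring.isElementary_of_exists_ringEquiv {R : Type*} [Ring R] (S : Subring R)
    (h : ∀ (n : ℕ) (x : Fin n → S) (a : R), ∃ f : R ≃+* R, (∀ i, f (x i) = x i) ∧ f a ∈ S) :
    S.IsElementary := by
  let _ : CompatibleRing R := compatibleRingOfRing R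
  -- Tarski–Vaught: if `a` is a witness in `R`, then so is `f a`, as `f` fixes the parameters.
  refine S.toRingSubstructure.isElementary_of_exists fun n φ x a hφ => ?_
  obtain ⟨f, hfx, hfa⟩ := h n x a
  let g : Language.ring.Equiv R R := languageEquivEquivRingEquiv.symm f
  refine ⟨⟨f a, hfa⟩, ?_⟩
  rw [← Language.StrongHomClass.realize_boundedFormula g φ] at hφ
  convert hφ using 1
  funext i
  refine Fin.lastCases ?_ (fun i => ?_) i
  · simp only [Function.comp_apply, Fin.snoc_last]
    rfl
  · simp only [Function.comp_apply, Fin.snoc_castSucc]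
    exact (hfx i).symm

end Transfer

namespace FreeAlgebra

variable {K : Type*} [Field K]

/-- The algebra map of free algebras induced by a map of generators. -/
def mapGenerators (K : Type*) [Field K] {Z W : Type*} (σ : Z → W) :
    FreeAlgebra K Z →ₐ[K] FreeAlgebra K W :=
  FreeAlgebra.lift K fun z => FreeAlgebra.ι K (σ z)

@[simp]
theorem mapGenerators_ι {Z W : Type*} (σ : Z → W) (z : Z) :
    mapGenerators K σ (ι K z) = ι K (σ z) := by
  simp [mapGenerators]

theorem mapGenerators_mapGenerators {Z W V : Type*} (τ : W → V) (σ : Z → W)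
    (a : FreeAlgebra K Z) :
    mapGenerators K τ (mapGenerators K σ a) = mapGenerators K (τ ∘ σ) a := by
  have : (mapGenerators K τ).comp (mapGenerators K σ) = mapGenerators K (τ ∘ σ) := by
    ext z
    simp
  exact DFunLike.congr_fun this a

/-- The automorphism of a free algebra induced by a permutation of the generators. -/
def permGenerators (K : Type*) [Field K] {Z : Type*} (σ : Equiv.Perm Z) :
    FreeAlgebra K Z ≃ₐ[K] FreeAlgebra K Z :=
  AlgEquiv.ofAlgHom (mapGenerators K σ) (mapGenerators K σ.symm) (by ext z; simp)
    (by ext z; simp)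

/-- Every element of a free algebra involves only finitely many generators. -/
theorem exists_finite_mapGenerators_eq {Z : Type*} (a : FreeAlgebra K Z) :
    ∃ s : Set Z, s.Finite ∧ ∀ (W : Type v) (σ τ : Z → W), Set.EqOn σ τ s →
      mapGenerators K σ a = mapGenerators K τ a := by
  induction a with
  | grade0 r => exact ⟨∅, Set.finite_empty, fun W σ τ _ => by simp⟩
  | grade1 z => exact ⟨{z}, Set.finite_singleton z, fun W σ τ h => by simp [h rfl]⟩
  | mul a b iha ihb =>
    obtain ⟨s, hs, ha⟩ := iha
    obtain ⟨t, ht, hb⟩ := ihb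
    exact ⟨s ∪ t, hs.union ht, fun W σ τ h => by
      rw [map_mul, map_mul, ha W σ τ (h.mono Set.subset_union_left),
        hb W σ τ (h.mono Set.subset_union_right)]⟩
  | add a b iha ihb =>
    obtain ⟨s, hs, ha⟩ := iha
    obtain ⟨t, ht, hb⟩ := ihb
    exact ⟨s ∪ t, hs.union ht, fun W σ τ h => by
      rw [map_add, map_add, ha W σ τ (h.mono Set.subset_union_left),
        hb W σ τ (h.mono Set.subset_union_right)]⟩

/-- Every element of a free algebra on finitely many generators is a constant plus an element of
the right ideal they generate. -/
theorem exists_eq_algebraMap_add_sum {Z : Type*} [Fintype Z] (a : FreeAlgebra K Z) :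
    ∃ (c : K) (b : Z → FreeAlgebra K Z), a = algebraMap K _ c + ∑ z, ι K z * b z := by
  classical
  induction a with
  | grade0 r => exact ⟨r, 0, by simp⟩
  | grade1 z => exact ⟨0, Pi.single z 1, by simp [Pi.single_apply]⟩
  | mul a₁ a₂ ih₁ ih₂ =>
    obtain ⟨c, b, rfl⟩ := ih₁
    obtain ⟨d, e, he⟩ := ih₂
    -- Only the summand c * a₂ needs the expansion of a₂; c moves past each generator because it is
    -- central.
    refine ⟨c * d, fun z => algebraMap K _ c * e z + b z * a₂, ?_⟩
    simp only [mul_add, Finset.sum_add_distrib, ← mul_assoc, ← Finset.sum_mul,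
      ← Algebra.commutes c (ι K _), map_mul]
    rw [add_mul, ← add_assoc]
    congr 1
    rw [he, mul_add, Finset.mul_sum]
    simp only [mul_assoc]
  | add a₁ a₂ ih₁ ih₂ =>
    obtain ⟨c, b, rfl⟩ := ih₁
    obtain ⟨d, e, rfl⟩ := ih₂
    refine ⟨c + d, b + e, ?_⟩
    simp only [map_add, Pi.add_apply, mul_add, Finset.sum_add_distrib]
    abel

end FreeAlgebra

/-- A finite set can be moved into an infinite set by a permutation fixing a prescribed finite
subset of the infinite set. -/
theorem Equiv.Perm.exists_fix_mapsTo_of_infinite {Z : Type*} {A T s : Set Z} (hA : A.Infinite)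
    (hT : T.Finite) (hTA : T ⊆ A) (hs : s.Finite) :
    ∃ σ : Equiv.Perm Z, (∀ z ∈ T, σ z = z) ∧ ∀ z ∈ s, σ z ∈ A := by
  classical
  induction s, hs using Set.Finite.induction_on with
  | empty => exact ⟨1, by simp, by simp⟩
  | @insert z s _ hs ih =>
    obtain ⟨σ, hσT, hσs⟩ := ih
    by_cases hz : σ z ∈ A
    · exact ⟨σ, hσT, by simpa [hz] using hσs⟩
    -- Avoiding T and σ(s) ensures that the swap below disturbs nothing already arranged.
    obtain ⟨w, hwA, hw⟩ := (hA.sdiff (hT.union (hs.image σ))).nonempty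
    refine ⟨Equiv.swap (σ z) w * σ, fun y hy => ?_, fun y hy => ?_⟩
    · rw [Equiv.Perm.mul_apply, hσT y hy]
      refine Equiv.swap_apply_of_ne_of_ne ?_ ?_
      · rintro rfl
        exact hz (hTA hy)
      · rintro rfl
        exact hw (.inl hy)
    · rcases hy with rfl | hy
      · simpa using hwA
      · rw [Equiv.Perm.mul_apply, Equiv.swap_apply_of_ne_of_ne]
        · exact hσs y hy
        · intro h
          exact hz (h ▸ hσs y hy)
        · rintro rfl
          exact hw (.inr ⟨y, hy, rfl⟩)

open FreeAlgebra in
theorem freeSubring_isElementary_of_infinite (K : Type u) [Field K] {U : Type v} {X Z : Set U}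
    (h : X ⊆ Z) (hX : X.Infinite) : (freeSubring K h).IsElementary := by
  classical
  have hincl (a : FreeAlgebra K X) :
      freeAlgebraInclusion K h a = mapGenerators K (Set.inclusion h) a := rfl
  refine Subring.isElementary_of_exists_ringEquiv _ fun n x a => ?_
  have hx (i : Fin n) : ∃ b, mapGenerators K (Set.inclusion h) b = (x i : FreeAlgebra K Z) :=
    (x i).2
  choose b hb using hx
  choose T hT hTb using fun i => exists_finite_mapGenerators_eq (b i)
  obtain ⟨s, hs, hsa⟩ := exists_finite_mapGenerators_eq a
  let A : Set Z := Set.range (Set.inclusion h)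
  have hA : A.Infinite := by
    have := hX.to_subtype
    exact Set.infinite_range_of_injective (Set.inclusion_injective h)
  obtain ⟨σ, hσT, hσs⟩ := Equiv.Perm.exists_fix_mapsTo_of_infinite (A := A)
    (T := Set.inclusion h '' ⋃ i, T i) hA ((Set.finite_iUnion hT).image _)
    (Set.image_subset_range _ _) hs
  refine ⟨permGenerators K σ, fun i => ?_, ?_⟩
  · change mapGenerators K σ (x i : FreeAlgebra K Z) = _
    rw [← hb i, mapGenerators_mapGenerators]
    exact hTb i _ _ _ fun z hz => hσT _ ⟨z, Set.mem_iUnion.2 ⟨i, hz⟩, rfl⟩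
  · obtain ⟨x₀, hx₀⟩ := hX.nonempty
    -- τ is σ with values forced into `X`; the default x₀ is never used on s, the only generators
    -- that matter for `a`.
    let τ : Z → X := fun z => if hz : ((σ z : Z) : U) ∈ X then ⟨_, hz⟩ else ⟨x₀, hx₀⟩
    refine ⟨mapGenerators K τ a, ?_⟩
    change mapGenerators K (Set.inclusion h) _ = mapGenerators K σ a
    rw [mapGenerators_mapGenerators]
    refine hsa _ _ _ fun z hz => ?_
    obtain ⟨y, hy⟩ := hσs z hz
    have hzX : ((σ z : Z) : U) ∈ X := by
      rw [← hy]
      exact y.2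
    ext
    simp [τ, hzX]

open FreeAlgebra in
theorem not_isElementary_freeSubring_of_finite (K : Type u) [Field K] {U : Type v} {X Z : Set U}
    (h : X ⊂ Z) (hX : X.Finite) : ¬ (freeSubring K h.subset).IsElementary := by
  classical
  intro hS
  have := hX.fintype
  obtain ⟨y, hyZ, hyX⟩ := Set.exists_of_ssubset h
  let g : FreeAlgebra K X →+* freeSubring K h.subset :=
    (freeAlgebraInclusion K h.subset : FreeAlgebra K X →+* FreeAlgebra K Z).rangeRestrict
  have hg : Function.Surjective g := RingHom.rangeRestrict_surjective _
  obtain ⟨b, v, hbv⟩ := hS.exists_regular_sub_sum (fun x => g (ι K x)) (fun a => by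
    obtain ⟨a, rfl⟩ := hg a
    obtain ⟨c, b, ha⟩ := exists_eq_algebraMap_add_sum a
    -- c = 0 needs no separate case, since 0⁻¹ = 0 still gives c * c⁻¹ * c = c.
    refine ⟨fun x => g (b x), g (algebraMap K _ c⁻¹), ?_⟩
    simp only [← map_mul, ← map_sum, ← map_sub]
    rw [ha, add_sub_cancel_right, ← map_mul, ← map_mul, mul_inv_mul_cancel]) (ι K ⟨y, hyZ⟩)
  let q : FreeAlgebra K Z →ₐ[K] Polynomial K :=
    FreeAlgebra.lift K fun z => if (z : U) ∈ X then 0 else Polynomial.X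
  have hqx (x : X) : q (g (ι K x)) = 0 := by
    change q (freeAlgebraInclusion K h.subset (ι K x)) = 0
    simp [q, freeAlgebraInclusion]
  have hqy : q (ι K ⟨y, hyZ⟩) = Polynomial.X := by simp [q, hyX]
  -- Under `q` the relation becomes X * q(v) * X = X in K[X]; cancelling makes X a unit.
  have := congrArg q hbv
  simp only [map_mul, map_sub, map_sum, hqx, hqy, zero_mul, Finset.sum_const_zero, sub_zero]
    at this
  exact Polynomial.not_isUnit_X (.of_mul_eq_one _
    (mul_right_cancel₀ Polynomial.X_ne_zero (this.trans (one_mul _).symm)))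

theorem mainTheorem12 {U : Type v} (X Y : Set U) (hXY : Disjoint X Y) (hX : X.Nonempty)
    (hY : Y.Nonempty) (K : Type u) [Field K] :
    (freeSubring K (Set.subset_union_left : X ⊆ X ∪ Y)).IsElementary ↔ X.Infinite := by
  refine ⟨fun hS hfin => ?_, freeSubring_isElementary_of_infinite K _⟩
  obtain ⟨y, hy⟩ := hY
  have h : X ⊂ X ∪ Y := (Set.ssubset_iff_of_subset Set.subset_union_left).2
    ⟨y, .inr hy, fun hyX => Set.disjoint_left.1 hXY hyX hy⟩
  exact not_isElementary_freeSubring_of_finite K h hfin hS
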